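/- There exist universal constants $c_1,c_2>0$ such that the following holds. Let $n,K,r\ge 1$ be integers and let $\mu$ be a real number with $0<\mu\le 1/100$, $c_1\log n\le K\le n/2$ and $\mu^2\le c_2\,n/K^2$. Let $C_1,\dots,C_r\subseteq\{1,\dots,n\}$ be pairwise disjoint sets of rows and $D_1,\dots,D_r\subseteq\{1,\dots,n\}$ pairwise disjoint sets of columns, all of size $K$ (so that $rK\le n$), and let $Y^*\in\{0,1\}^{n\times n}$ be the matrix with $Y^*_{ij}=1$ if and only if $(i,j)\in C_m\times D_m$ for some $m$. Let $A=\mu Y^*+\Delta$, where the entries $\Delta_{ij}$ of $\Delta\in\mathbb{R}^{n\times n}$ are independent standard Gaussian $N(0,1)$ random variables. Then, with probability at least $1-n^{-10}$, every optimal solution $Y$ of the convex program $$\max_{Y\in\mathbb{R}^{n\times n}}\ \sum_{i,j}A_{ij}Y_{ij}\quad\text{subject to}\quad \|Y\|_*\le rK,\qquad \sum_{i,j}Y_{ij}=rK^2,\qquad 0\le Y_{ij}\le 1\ \text{ for all } i,j,$$ where $\|Y\|_*$ is the nuclear norm (the sum of the singular values), has support $\{(i,j):Y_{ij}\ne 0\}$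 different from the support of $Y^*$. -/

import Mathlib

noncomputable section

/-- A bi-clustering of `nL` rows and `nR` columns: `r` pairwise disjoint left clusters of size `KL`
and `r` pairwise disjoint right clusters of size `KR`. Rows and columns outside all the clusters
are isolated. -/
structure BiClustering (nL nR KL KR r : ℕ) where
  /-- the left clusters -/
  C : Fin r → Finset (Fin nL)
  /-- the right clusters -/
  D : Fin r → Finset (Fin nR)
  card_C : ∀ m, (C m).card = KL
  card_D : ∀ m, (D m).card = KR
  disjoint_C : Pairwise fun m m' => Disjoint (C m) (C m')
  disjoint_D : Pairwise fun m m' => Disjoint (D m) (D m')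

namespace BiClustering

variable {nL nR KL KR r : ℕ}

open Classical in
/-- The bi-clustering matrix `Y*`: the entry at `(i, j)` is `1` if `(i, j) ∈ C m ×ˢ D m` for some
`m`, and `0` otherwise. -/
def matrix (B : BiClustering nL nR KL KR r) : Matrix (Fin nL) (Fin nR) ℝ :=
  Matrix.of fun i j => if ∃ m, i ∈ B.C m ∧ j ∈ B.D m then 1 else 0

open Classical in
/-- The observed matrix `A`, given the noise matrix `Δ`: the entry at `(i, j)` is `μ + Δ i j` if
`(i, j) ∈ C m ×ˢ D m` for some `m`, and `Δ i j` otherwise. -/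
def observation (B : BiClustering nL nR KL KR r) (μ : ℝ) (Δ : Matrix (Fin nL) (Fin nR) ℝ) :
    Matrix (Fin nL) (Fin nR) ℝ :=
  Matrix.of fun i j => if ∃ m, i ∈ B.C m ∧ j ∈ B.D m then μ + Δ i j else Δ i j

end BiClustering

/-- The noise entries are independent standard Gaussian random variables. -/
structure IsGaussianNoise {Ω : Type*} [MeasurableSpace Ω] {nL nR : ℕ}
    (Δ : Ω → Matrix (Fin nL) (Fin nR) ℝ) (P : MeasureTheory.Measure Ω) : Prop where
  hasLaw : ∀ i j,
    ProbabilityTheory.HasLaw (fun ω => Δ ω i j) (ProbabilityTheory.gaussianReal 0 1) P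
  indep : ProbabilityTheory.iIndepFun (fun (p : Fin nL × Fin nR) ω => Δ ω p.1 p.2) P

/-- The nuclear (trace) norm of a real matrix: the sum of its singular values. -/
def nuclearNorm {nL nR : ℕ} (Y : Matrix (Fin nL) (Fin nR) ℝ) : ℝ :=
  (Matrix.toEuclideanLin Y).singularValues.sum fun _ s => s

/-- The support of a matrix: the set of positions of its nonzero entries. -/
def matrixSupport {nL nR : ℕ} (Y : Matrix (Fin nL) (Fin nR) ℝ) : Set (Fin nL × Fin nR) :=
  {p | Y p.1 p.2 ≠ 0}

/-- The feasible set of the convex program: `‖Y‖_* ≤ r √(KL KR)`, `∑ Y i j = r KL KR`,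
and `0 ≤ Y i j ≤ 1`. -/
def cvxFeasible (nL nR KL KR r : ℕ) : Set (Matrix (Fin nL) (Fin nR) ℝ) :=
  {Y | nuclearNorm Y ≤ r * √((KL : ℝ) * KR) ∧
    ∑ i, ∑ j, Y i j = (r : ℝ) * KL * KR ∧
    ∀ i j, 0 ≤ Y i j ∧ Y i j ≤ 1}

/-- `Y` is an optimal solution of the convex program with data `A`: it is feasible and maximizes
`∑ A i j * Y i j` over the feasible set. -/
def IsCvxOptimal {nL nR : ℕ} (KL KR r : ℕ) (A Y : Matrix (Fin nL) (Fin nR) ℝ) : Prop :=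
  Y ∈ cvxFeasible nL nR KL KR r ∧
    ∀ Z ∈ cvxFeasible nL nR KL KR r, ∑ i, ∑ j, A i j * Z i j ≤ ∑ i, ∑ j, A i j * Y i j

end

/-! A feasible matrix with the support of `Y*` equals `Y*` (`matrixSupport_eq_iff`), so it is enough
to exhibit a feasible matrix with a larger objective than `Y*`.

The competitor is `Z = (1 - tσ) Y* + tη W + t M` with small `t > 0`. Here `M` is the indicator of
the noise entries above `1/2`, and `W` extends one block `C m₀ × D m₀` to the other columns. With
`N` the sum of the entries of `M`, of order `n²`, the gain from `M` is at least `N/2` per unit of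
`t`, while its nuclear norm is at most `b = √(nN)`, of order `n^(3/2)`. Shrinking `Y*` pays for this
norm but loses mass. `W` restores the mass almost for free: it perturbs the right vector of a
rank-one block in an orthogonal direction, so the norm grows only to second order
(`nuclearNorm_perturbation_le`).

The signal lost is about `2bKμ + Nμ`. It stays below `N/2` when `μ` and `Kμ/√n` are small.
`not_isCvxOptimal_matrix` is the resulting deterministic criterion; Gaussian and Hoeffding tails
supply its hypotheses. -/

/-! ### Nuclear norm bounds through Bessel's inequality. -/

open scoped InnerProductSpace in
/-- The sum of the singular values of `T` is `∑ ⟪u k, T (v k)⟫` for an orthonormal basis `v` and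
a family `u` of orthogonal vectors of norm at most one. -/
theorem LinearMap.exists_sum_singularValues_eq {E F : Type*} [NormedAddCommGroup E]
    [InnerProductSpace ℝ E] [FiniteDimensional ℝ E] [NormedAddCommGroup F]
    [InnerProductSpace ℝ F] [FiniteDimensional ℝ F] (T : E →ₗ[ℝ] F) {n : ℕ}
    (hn : Module.finrank ℝ E = n) :
    ∃ (v : OrthonormalBasis (Fin n) ℝ E) (u : Fin n → F),
      (∀ k, ‖u k‖ ≤ 1) ∧ (∀ a, ∑ k, ⟪u k, a⟫_ℝ ^ 2 ≤ ‖a‖ ^ 2) ∧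
      (T.singularValues.sum fun _ s => s) = ∑ k, ⟪u k, T (v k)⟫_ℝ := by
  classical
  set hT := T.isSymmetric_adjoint_comp_self
  set v := hT.eigenvectorBasis hn
  set σ : Fin n → ℝ := fun k => T.singularValues k
  have hσ (k : Fin n) : σ k ^ 2 = hT.eigenvalues hn k := T.sq_singularValues_fin hn k
  have hinner (k l : Fin n) : ⟪T (v k), T (v l)⟫_ℝ = if k = l then σ k ^ 2 else 0 := by
    have h1 : ⟪T (v k), T (v l)⟫_ℝ = ⟪(T.adjoint ∘ₗ T) (v k), v l⟫_ℝ := by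
      rw [LinearMap.comp_apply, LinearMap.adjoint_inner_left]
    rw [h1, hT.apply_eigenvectorBasis hn k, inner_smul_left,
      orthonormal_iff_ite.mp v.orthonormal k l, hσ]
    simp
  -- Since `0⁻¹ = 0`, `u k` vanishes when `σ k = 0`; the nonzero `u k` are orthonormal.
  set u : Fin n → F := fun k => (σ k)⁻¹ • T (v k)
  have huu (k l : Fin n) : ⟪u k, u l⟫_ℝ = if k = l ∧ σ k ≠ 0 then 1 else 0 := by
    simp only [u, inner_smul_left, inner_smul_right, hinner]
    by_cases hkl : k = l
    · subst hkl
      by_cases h0 : σ k = 0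
      · simp [h0]
      · simp [h0]
        field_simp
    · simp [hkl]
  refine ⟨v, u, fun k => ?_, fun a => ?_, ?_⟩
  · have h := huu k k
    rw [real_inner_self_eq_norm_sq] at h
    have : ‖u k‖ ^ 2 ≤ 1 := by rw [h]; split_ifs <;> norm_num
    nlinarith [norm_nonneg (u k)]
  · let w : {k : Fin n // σ k ≠ 0} → F := fun k => u k
    have hw : Orthonormal ℝ w := by
      rw [orthonormal_iff_ite]
      rintro ⟨k, hk⟩ ⟨l, hl⟩
      simp [w, huu, hk]
    have hb := hw.sum_inner_products_le a (s := Finset.univ)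
    refine le_trans (le_of_eq ?_) hb
    have h0 : ∀ k, σ k = 0 → ⟪u k, a⟫_ℝ ^ 2 = 0 := by
      intro k hk
      simp [u, hk]
    rw [← Finset.sum_filter_add_sum_filter_not Finset.univ (fun k => σ k ≠ 0),
      Finset.sum_eq_zero (s := Finset.univ.filter fun k => ¬ σ k ≠ 0), add_zero,
      ← Finset.sum_subtype_eq_sum_filter, Finset.subtype_univ]
    · simp [w]
    · intro k hk
      exact h0 k (by simpa using hk)
  · rw [Finsupp.sum_of_support_subset _ (s := Finset.range n) _ _ (by simp),
      Finset.sum_range]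
    · refine Finset.sum_congr rfl fun k _ => ?_
      simp only [u, inner_smul_left, hinner, if_true]
      change σ k = _
      by_cases h0 : σ k = 0
      · simp [h0]
      · simp
        field_simp
    · intro k hk
      by_contra hlt
      exact Finsupp.mem_support_iff.mp hk
        (T.singularValues_of_finrank_le (by rw [hn]; simpa using hlt))

/-- A bilinear representation of the nuclear norm, with test vectors satisfying Bessel's
inequality. -/
theorem exists_nuclearNorm_eq {nL nR : ℕ} (Y : Matrix (Fin nL) (Fin nR) ℝ) :
    ∃ (v : Fin nR → Fin nR → ℝ) (u : Fin nR → Fin nL → ℝ),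
      (∀ k, ∑ i, u k i ^ 2 ≤ 1) ∧
      (∀ a : Fin nL → ℝ, ∑ k, (∑ i, u k i * a i) ^ 2 ≤ ∑ i, a i ^ 2) ∧
      (∀ b : Fin nR → ℝ, ∑ k, (∑ j, v k j * b j) ^ 2 ≤ ∑ j, b j ^ 2) ∧
      nuclearNorm Y = ∑ k, ∑ i, ∑ j, u k i * Y i j * v k j := by
  obtain ⟨v, u, hu, hb, hsum⟩ := (Matrix.toEuclideanLin Y).exists_sum_singularValues_eq
    (n := nR) (by simp)
  refine ⟨fun k j => v k j, fun k i => u k i, fun k => ?_, fun a => ?_, fun b => ?_, ?_⟩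
  · rw [← EuclideanSpace.real_norm_sq_eq]
    nlinarith [hu k, norm_nonneg (u k)]
  · have h := hb (WithLp.toLp 2 a)
    rw [EuclideanSpace.real_norm_sq_eq] at h
    simpa [PiLp.inner_apply, mul_comm] using h
  · have h := v.sum_sq_norm_inner_right (WithLp.toLp 2 b)
    rw [EuclideanSpace.real_norm_sq_eq] at h
    refine le_of_eq ?_
    simpa [PiLp.inner_apply, mul_comm] using h
  · rw [nuclearNorm, hsum]
    refine Finset.sum_congr rfl fun k _ => ?_
    simp only [PiLp.inner_apply, Matrix.toLpLin_apply, Matrix.mulVec, dotProduct, RCLike.inner_apply,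
      conj_trivial, Finset.sum_mul]
    refine Finset.sum_congr rfl fun i _ => Finset.sum_congr rfl fun j _ => by ring

/-- The nuclear norm of a sum of rank-one matrices and a matrix `M` is at most the sum of the
nuclear norms of the former plus `√nR` times the Frobenius norm of the latter. -/
theorem nuclearNorm_sum_vecMulVec_add_le {nL nR r : ℕ} (a : Fin r → Fin nL → ℝ)
    (b : Fin r → Fin nR → ℝ) (M : Matrix (Fin nL) (Fin nR) ℝ) :
    nuclearNorm (Matrix.of fun i j => (∑ m, a m i * b m j) + M i j) ≤
      (∑ m, √(∑ i, a m i ^ 2) * √(∑ j, b m j ^ 2)) + √nR * √(∑ i, ∑ j, M i j ^ 2) := by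
  obtain ⟨v, u, hu, hub, hvb, hY⟩ :=
    exists_nuclearNorm_eq (Matrix.of fun i j => (∑ m, a m i * b m j) + M i j)
  have hsplit : ∑ k, ∑ i, ∑ j, u k i * ((∑ m, a m i * b m j) + M i j) * v k j =
      (∑ m, ∑ k, (∑ i, u k i * a m i) * ∑ j, v k j * b m j) +
        ∑ k, ∑ i, u k i * ∑ j, v k j * M i j := by
    rw [Finset.sum_comm (s := (Finset.univ : Finset (Fin r))), ← Finset.sum_add_distrib]
    refine Finset.sum_congr rfl fun k _ => ?_
    have h1 : ∑ m, (∑ i, u k i * a m i) * ∑ j, v k j * b m j =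
        ∑ i, ∑ j, u k i * (∑ m, a m i * b m j) * v k j := by
      simp_rw [Finset.sum_mul_sum]
      rw [Finset.sum_comm]
      refine Finset.sum_congr rfl fun i _ => ?_
      rw [Finset.sum_comm]
      refine Finset.sum_congr rfl fun j _ => ?_
      rw [Finset.mul_sum, Finset.sum_mul]
      exact Finset.sum_congr rfl fun m _ => by ring
    rw [h1, ← Finset.sum_add_distrib]
    refine Finset.sum_congr rfl fun i _ => ?_
    rw [Finset.mul_sum, ← Finset.sum_add_distrib]
    refine Finset.sum_congr rfl fun j _ => by ring
  rw [hY]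
  simp only [Matrix.of_apply]
  rw [hsplit]
  refine add_le_add (Finset.sum_le_sum fun m _ => ?_) ?_
  · refine (Real.sum_mul_le_sqrt_mul_sqrt _ _ _).trans ?_
    exact mul_le_mul (Real.sqrt_le_sqrt (hub _)) (Real.sqrt_le_sqrt (hvb _)) (Real.sqrt_nonneg _)
      (Real.sqrt_nonneg _)
  -- Cauchy–Schwarz over pairs `(k, i)`: the `nR` vectors `u k` contribute `√nR`, and Bessel for `v`
  -- applied to each row of `M` gives the Frobenius norm.
  · simp only [← Finset.sum_product']
    refine (Real.sum_mul_le_sqrt_mul_sqrt _ (fun x : Fin nR × Fin nL => u x.1 x.2)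
      (fun x => ∑ j, v x.1 j * M x.2 j)).trans ?_
    refine mul_le_mul (Real.sqrt_le_sqrt ?_) (Real.sqrt_le_sqrt ?_) (Real.sqrt_nonneg _)
      (Real.sqrt_nonneg _)
    · rw [Finset.sum_product]
      calc _ ≤ ∑ _k : Fin nR, (1 : ℝ) := Finset.sum_le_sum fun k _ => hu k
        _ = nR := by simp
    · rw [Finset.sum_product_right, Finset.sum_product]
      exact Finset.sum_le_sum fun i _ => hvb (M i)

/-! ### The bi-clustering matrix and its perturbations. -/

namespace BiClustering

variable {nL nR KL KR r : ℕ}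

theorem matrix_nonneg (B : BiClustering nL nR KL KR r) (i : Fin nL) (j : Fin nR) :
    0 ≤ B.matrix i j := by
  simp only [matrix, Matrix.of_apply]
  split_ifs <;> norm_num

theorem matrix_le_one (B : BiClustering nL nR KL KR r) (i : Fin nL) (j : Fin nR) :
    B.matrix i j ≤ 1 := by
  simp only [matrix, Matrix.of_apply]
  split_ifs <;> norm_num

theorem matrix_eq_sum (B : BiClustering nL nR KL KR r) (i : Fin nL) (j : Fin nR) :
    B.matrix i j = ∑ m, (if i ∈ B.C m then 1 else 0) * (if j ∈ B.D m then 1 else 0) := by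
  simp only [matrix, Matrix.of_apply]
  split_ifs with h
  · obtain ⟨m, hi, hj⟩ := h
    rw [Finset.sum_eq_single m]
    · simp [hi, hj]
    · intro m' _ hm
      have : i ∉ B.C m' := fun hi' =>
        Finset.disjoint_left.mp (B.disjoint_C hm) hi' hi
      simp [this]
    · simp
  · symm
    apply Finset.sum_eq_zero
    intro m _
    by_cases hi : i ∈ B.C m
    · have : j ∉ B.D m := fun hj => h ⟨m, hi, hj⟩
      simp [this]
    · simp [hi]

theorem sum_indicator_C (B : BiClustering nL nR KL KR r) (m : Fin r) :
    ∑ i, (if i ∈ B.C m then (1 : ℝ) else 0) = KL := by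
  simp [B.card_C]

theorem sum_indicator_D (B : BiClustering nL nR KL KR r) (m : Fin r) :
    ∑ j, (if j ∈ B.D m then (1 : ℝ) else 0) = KR := by
  simp [B.card_D]

theorem sum_matrix (B : BiClustering nL nR KL KR r) :
    ∑ i, ∑ j, B.matrix i j = (r : ℝ) * KL * KR := by
  simp_rw [matrix_eq_sum]
  calc _ = ∑ i, ∑ m, ∑ j, (if i ∈ B.C m then (1 : ℝ) else 0) * (if j ∈ B.D m then 1 else 0) :=
        Finset.sum_congr rfl fun i _ => Finset.sum_comm
    _ = ∑ m, ∑ i, ∑ j, (if i ∈ B.C m then (1 : ℝ) else 0) * (if j ∈ B.D m then 1 else 0) :=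
        Finset.sum_comm
    _ = ∑ m : Fin r, (KL : ℝ) * KR := by
        refine Finset.sum_congr rfl fun m _ => ?_
        rw [← Finset.sum_mul_sum, sum_indicator_C, sum_indicator_D]
    _ = _ := by simp [mul_assoc]

theorem mul_card_C_le (B : BiClustering nL nR KL KR r) : r * KL ≤ nL := by
  have h := Finset.card_biUnion (s := Finset.univ) (t := B.C)
    (fun m _ m' _ hm => B.disjoint_C hm)
  simp only [B.card_C, Finset.sum_const, Finset.card_univ, Fintype.card_fin, smul_eq_mul] at h
  rw [← h]
  exact card_finset_fin_le _

/-- The indicator matrix of `C m ×ˢ (D m)ᶜ`. -/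
def widening (B : BiClustering nL nR KL KR r) (m : Fin r) : Matrix (Fin nL) (Fin nR) ℝ :=
  Matrix.of fun i j => (if i ∈ B.C m then 1 else 0) * (1 - if j ∈ B.D m then 1 else 0)

theorem widening_nonneg (B : BiClustering nL nR KL KR r) (m : Fin r) (i : Fin nL) (j : Fin nR) :
    0 ≤ B.widening m i j := by
  simp only [widening, Matrix.of_apply]
  split_ifs <;> norm_num

/-- Rows of `C m` lie in no other left cluster, so the widening misses every block. -/
theorem widening_le_one (B : BiClustering nL nR KL KR r) (m : Fin r) (i : Fin nL) (j : Fin nR) :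
    B.widening m i j ≤ 1 - B.matrix i j := by
  have hle := B.matrix_le_one i j
  by_cases hi : i ∈ B.C m
  · by_cases hj : j ∈ B.D m
    · simp [widening, hi, hj, hle]
    · have : ¬ ∃ m', i ∈ B.C m' ∧ j ∈ B.D m' := by
        rintro ⟨m', hi', hj'⟩
        have : m' = m := by
          by_contra hne
          exact Finset.disjoint_left.mp (B.disjoint_C hne) hi' hi
        exact hj (this ▸ hj')
      simp [widening, hi, hj, matrix, this]
  · simp [widening, hi, hle]

theorem sum_widening (B : BiClustering nL nR KL KR r) (m : Fin r) :
    ∑ i, ∑ j, B.widening m i j = (KL : ℝ) * (nR - KR) := by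
  simp only [widening, Matrix.of_apply]
  rw [← Finset.sum_mul_sum, sum_indicator_C, Finset.sum_sub_distrib, sum_indicator_D]
  simp

/-- Equal supports and entries at most one give `Y ≤ Y*` entrywise; equal total sums then force
equality. -/
theorem matrixSupport_eq_iff (B : BiClustering nL nR KL KR r) {Y : Matrix (Fin nL) (Fin nR) ℝ}
    (hY : Y ∈ cvxFeasible nL nR KL KR r) :
    matrixSupport Y = matrixSupport B.matrix ↔ Y = B.matrix := by
  refine ⟨fun h => ?_, fun h => by rw [h]⟩
  obtain ⟨-, hsum, hbd⟩ := hY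
  have hle : ∀ i j, Y i j ≤ B.matrix i j := by
    intro i j
    by_cases h0 : Y i j = 0
    · rw [h0]; exact B.matrix_nonneg i j
    · have hs : (i, j) ∈ matrixSupport B.matrix := h ▸ h0
      have : B.matrix i j = 1 := by
        simp only [matrixSupport, Set.mem_ofPred_eq, matrix, Matrix.of_apply] at hs ⊢
        split_ifs at hs ⊢ <;> simp_all
      rw [this]; exact (hbd i j).2
  have hrow := (Finset.sum_eq_sum_iff_of_le (fun i _ => Finset.sum_le_sum fun j _ => hle i j)).mp
    (hsum.trans B.sum_matrix.symm)
  ext i j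
  exact (Finset.sum_eq_sum_iff_of_le (fun j _ => hle i j)).mp (hrow i (Finset.mem_univ i)) j
    (Finset.mem_univ j)

/-- Widening one cluster and adding an arbitrary matrix to a multiple of the bi-clustering matrix
increases the nuclear norm only to second order in the size of the widening. -/
theorem nuclearNorm_perturbation_le {n K : ℕ} (B : BiClustering n n K K r) (m₀ : Fin r)
    (M : Matrix (Fin n) (Fin n) ℝ) {c e x : ℝ} (hc : 0 ≤ c) (hx : 0 ≤ x)
    (hex : e ^ 2 * K * (n - K) ≤ 2 * c * K * x) :
    nuclearNorm (c • B.matrix + e • B.widening m₀ + M) ≤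
      r * (c * K) + x + √n * √(∑ i, ∑ j, M i j ^ 2) := by
  set a : Fin r → Fin n → ℝ := fun m i => if i ∈ B.C m then 1 else 0
  -- The two indicators have disjoint supports, so the widened factor has squared norm `c²K + e²(n -
  -- K)`, without a cross term.
  set b : Fin r → Fin n → ℝ := fun m j =>
    c * (if j ∈ B.D m then 1 else 0) +
      (if m = m₀ then e else 0) * (1 - if j ∈ B.D m then 1 else 0)
  have hZ : c • B.matrix + e • B.widening m₀ + M =
      Matrix.of fun i j => (∑ m, a m i * b m j) + M i j := by
    ext i j
    simp only [Matrix.add_apply, Matrix.smul_apply, Matrix.of_apply, smul_eq_mul, a, b,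
      matrix_eq_sum, mul_add, Finset.sum_add_distrib]
    congr 2
    · rw [Finset.mul_sum]
      exact Finset.sum_congr rfl fun m _ => by ring
    · rw [Finset.sum_eq_single m₀]
      · simp only [widening, Matrix.of_apply, if_true]
        ring
      · intro m _ hm
        simp [hm]
      · simp
  rw [hZ]
  refine (nuclearNorm_sum_vecMulVec_add_le a b M).trans ?_
  gcongr
  have ha (m : Fin r) : ∑ i, a m i ^ 2 = K := by
    rw [← B.sum_indicator_C m]
    refine Finset.sum_congr rfl fun i _ => ?_
    simp only [a]
    split_ifs <;> norm_num
  have hb (m : Fin r) : ∑ j, b m j ^ 2 =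
      c ^ 2 * K + (if m = m₀ then e else 0) ^ 2 * (n - K) := by
    have : ∀ j, b m j ^ 2 = c ^ 2 * (if j ∈ B.D m then (1 : ℝ) else 0) +
        (if m = m₀ then e else 0) ^ 2 * (1 - if j ∈ B.D m then 1 else 0) := by
      intro j
      by_cases hj : j ∈ B.D m <;> simp [b, hj]
    simp_rw [this]
    rw [Finset.sum_add_distrib, ← Finset.mul_sum, ← Finset.mul_sum, Finset.sum_sub_distrib,
      sum_indicator_D]
    simp
  have hterm (m : Fin r) : √(∑ i, a m i ^ 2) * √(∑ j, b m j ^ 2) ≤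
      c * K + if m = m₀ then x else 0 := by
    rw [ha, hb, ← Real.sqrt_mul (Nat.cast_nonneg K)]
    have hK : (0 : ℝ) ≤ K := Nat.cast_nonneg K
    apply Real.sqrt_le_iff.mpr
    split_ifs
    · refine ⟨by positivity, ?_⟩
      nlinarith [sq_nonneg x]
    · refine ⟨by positivity, ?_⟩
      nlinarith
  calc _ ≤ ∑ m : Fin r, (c * K + if m = m₀ then x else 0) := Finset.sum_le_sum fun m _ => hterm m
    _ = _ := by simp [Finset.sum_add_distrib]

/-- A criterion for the bi-clustering matrix not to be optimal, with the perturbation given by a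
matrix `M` with entries in the unit interval. -/
theorem not_isCvxOptimal_matrix {n K : ℕ} (B : BiClustering n n K K r) (m₀ : Fin r)
    (hK : 0 < K) (hKn : K < n) (A M : Matrix (Fin n) (Fin n) ℝ)
    (hM0 : ∀ i j, 0 ≤ M i j) (hM1 : ∀ i j, M i j ≤ 1) {N b σ η : ℝ}
    (hN : ∑ i, ∑ j, M i j = N) (hb : b = √n * √N) (hσ : σ = 2 * b / (r * K) + N / (r * K ^ 2))
    (hη : η = 2 * b / (n - K)) (hσ1 : 1 ≤ σ)
    (hgain : 0 < (∑ i, ∑ j, A i j * M i j) - σ * (∑ i, ∑ j, A i j * B.matrix i j) +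
      η * ∑ i, ∑ j, A i j * B.widening m₀ i j) :
    ¬ IsCvxOptimal K K r A B.matrix := by
  rintro ⟨-, hopt⟩
  have hr : 0 < r := m₀.pos
  have hK' : (0 : ℝ) < K := by exact_mod_cast hK
  have hr' : (0 : ℝ) < r := by exact_mod_cast hr
  have hg : (0 : ℝ) < n - K := by rw [sub_pos]; exact_mod_cast hKn
  have hN0 : 0 ≤ N := by
    rw [← hN]; exact Finset.sum_nonneg fun i _ => Finset.sum_nonneg fun j _ => hM0 i j
  have hb0 : 0 ≤ b := by rw [hb]; positivity
  have hη0 : 0 ≤ η := by rw [hη]; positivity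
  have hηb : η * (n - K) = 2 * b := by rw [hη]; field_simp
  have hσb : σ * (r * K ^ 2) = 2 * b * K + N := by rw [hσ]; field_simp
  have hQ : 0 < 2 * σ + 2 * η + 1 := by linarith
  -- This `t` gives `tη ≤ 1 - tσ`, which bounds the cost of the widening by `tb`, and `tη + t ≤ 1`,
  -- which keeps entries off the blocks at most one.
  obtain ⟨t, ht0, ht⟩ : ∃ t : ℝ, 0 < t ∧ t * (2 * σ + 2 * η + 1) = 1 :=
    ⟨(2 * σ + 2 * η + 1)⁻¹, inv_pos.mpr hQ, inv_mul_cancel₀ hQ.ne'⟩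
  have htη : 0 ≤ t * η := by positivity
  have htσ : t ≤ t * σ := le_mul_of_one_le_right ht0.le hσ1
  set Z : Matrix (Fin n) (Fin n) ℝ := (1 - t * σ) • B.matrix + (t * η) • B.widening m₀ + t • M
  have hZ (i j) : Z i j = (1 - t * σ) * B.matrix i j + t * η * B.widening m₀ i j + t * M i j := by
    simp [Z]
  have hsq : √n * √(∑ i, ∑ j, (t • M) i j ^ 2) ≤ t * b := by
    have h1 : ∑ i, ∑ j, (t • M) i j ^ 2 ≤ t ^ 2 * N := by
      rw [← hN, Finset.mul_sum]
      refine Finset.sum_le_sum fun i _ => ?_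
      rw [Finset.mul_sum]
      refine Finset.sum_le_sum fun j _ => ?_
      rw [Matrix.smul_apply, smul_eq_mul, mul_pow]
      gcongr
      nlinarith [hM0 i j, hM1 i j]
    calc √n * √(∑ i, ∑ j, (t • M) i j ^ 2) ≤ √n * √(t ^ 2 * N) := by gcongr
      _ = t * b := by rw [Real.sqrt_mul (sq_nonneg t), Real.sqrt_sq ht0.le, hb]; ring
  have hfeas : Z ∈ cvxFeasible n n K K r := by
    refine ⟨?_, ?_, fun i j => ?_⟩
    · have hx : (t * η) ^ 2 * K * (n - K) ≤ 2 * (1 - t * σ) * K * (t * b) := by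
        have : (t * η) ^ 2 * K * (n - K) = 2 * K * (t * b) * (t * η) := by
          linear_combination t ^ 2 * η * K * hηb
        rw [this]
        have : 0 ≤ K * (t * b) := by positivity
        nlinarith
      have h := B.nuclearNorm_perturbation_le m₀ (t • M) (c := 1 - t * σ) (e := t * η)
        (x := t * b) (by nlinarith) (by positivity) hx
      rw [Real.sqrt_mul_self hK'.le]
      refine h.trans ?_
      -- Shrinking `Y*` frees `tσrK`, enough for `tb` from `M` and `tb` from the widening.
      have h2 : 2 * b ≤ σ * (r * K) := by
        rw [hσ, add_mul]
        have : 2 * b / (r * K) * (r * K) = 2 * b := by field_simp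
        rw [this]
        have : 0 ≤ N / (r * K ^ 2) * (r * K) := by positivity
        linarith
      nlinarith
    · simp only [hZ, Finset.sum_add_distrib, ← Finset.mul_sum, B.sum_matrix, B.sum_widening, hN]
      linear_combination t * K * hηb - t * hσb
    · rw [hZ]
      have h1 := B.matrix_nonneg i j
      have h2 := B.matrix_le_one i j
      have h3 := B.widening_nonneg m₀ i j
      have h4 := B.widening_le_one m₀ i j
      have h5 := hM0 i j
      have h6 := hM1 i j
      have h7 : t * M i j ≤ t := by nlinarith
      refine ⟨?_, ?_⟩
      · have : 0 ≤ 1 - t * σ := by nlinarith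
        positivity
      · have h8 : t * η * B.widening m₀ i j ≤ t * η * (1 - B.matrix i j) := by gcongr
        have h9 : (1 - t * σ) * B.matrix i j ≤ (1 - t) * B.matrix i j := by gcongr
        have h10 : (t * η + t) * (1 - B.matrix i j) ≤ 1 * (1 - B.matrix i j) := by
          gcongr
          · linarith
        nlinarith
  have h := hopt Z hfeas
  have hobj : ∑ i, ∑ j, A i j * Z i j = (1 - t * σ) * (∑ i, ∑ j, A i j * B.matrix i j) +
      t * η * (∑ i, ∑ j, A i j * B.widening m₀ i j) + t * ∑ i, ∑ j, A i j * M i j := by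
    simp only [hZ, Finset.mul_sum, ← Finset.sum_add_distrib]
    refine Finset.sum_congr rfl fun i _ => Finset.sum_congr rfl fun j _ => by ring
  rw [hobj] at h
  have := mul_pos ht0 hgain
  linarith

end BiClustering

/-! ### Concentration of the Gaussian noise. -/

open MeasureTheory ProbabilityTheory in
/-- A standard Gaussian random variable is sub-Gaussian with parameter `1`. -/
theorem ProbabilityTheory.HasLaw.hasSubgaussianMGF_one {Ω : Type*} [MeasurableSpace Ω] {P : Measure Ω} {X : Ω → ℝ}
    (hX : HasLaw X (gaussianReal 0 1) P) : HasSubgaussianMGF X 1 P := by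
  refine HasSubgaussianMGF.of_map (X := id) (Y := X) hX.aemeasurable ?_
  rw [hX.map_eq]
  exact ⟨fun t => integrable_exp_mul_gaussianReal t, fun t => by simp [mgf_id_gaussianReal]⟩

namespace IsGaussianNoise

open MeasureTheory ProbabilityTheory

variable {Ω : Type*} [MeasurableSpace Ω] {P : Measure Ω} {nL nR : ℕ}
  {Δ : Ω → Matrix (Fin nL) (Fin nR) ℝ}

/-- The Gaussian tail bound for a linear functional of the noise. -/
theorem measureReal_le_sum_mul_le (h : IsGaussianNoise Δ P)
    (w : Matrix (Fin nL) (Fin nR) ℝ) {ε : ℝ} (hε : 0 ≤ ε) :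
    P.real {ω | ε ≤ ∑ i, ∑ j, w i j * Δ ω i j} ≤
      Real.exp (-ε ^ 2 / (2 * ∑ i, ∑ j, w i j ^ 2)) := by
  have hind : iIndepFun (fun (q : Fin nL × Fin nR) ω => w q.1 q.2 * Δ ω q.1 q.2) P :=
    h.indep.comp (fun q x => w q.1 q.2 * x) fun q => by fun_prop
  have hsub (q : Fin nL × Fin nR) :
      HasSubgaussianMGF (fun ω => w q.1 q.2 * Δ ω q.1 q.2) (‖w q.1 q.2‖₊ ^ 2) P := by
    convert! (h.hasLaw q.1 q.2).hasSubgaussianMGF_one.const_mul (w q.1 q.2) using 1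
    exact NNReal.eq (show |w q.1 q.2| ^ 2 = w q.1 q.2 ^ 2 * 1 by rw [mul_one, sq_abs])
  have := HasSubgaussianMGF.measure_sum_ge_le_of_iIndepFun hind (s := Finset.univ)
    (fun q _ => hsub q) hε
  simpa [Fintype.sum_prod_type] using this

/-- Hoeffding's inequality for the number of noise entries above `1 / 2`. -/
theorem measureReal_sum_indicator_le [IsProbabilityMeasure P] (h : IsGaussianNoise Δ P)
    {p : ℝ} (hp : p = (gaussianReal 0 1).real (Set.Ioi (1 / 2))) :
    P.real {ω | ∑ i, ∑ j, (if 1 / 2 < Δ ω i j then (1 : ℝ) else 0) ≤ nL * nR * p / 2} ≤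
      Real.exp (-(nL * nR * p ^ 2 / 2)) := by
  set f : ℝ → ℝ := fun x => if 1 / 2 < x then 1 else 0
  have hf : Measurable f := Measurable.ite measurableSet_Ioi measurable_const measurable_const
  have hint (i j) : P[fun ω => f (Δ ω i j)] = p := by
    have h1 := (h.hasLaw i j).integral_comp (f := f) hf.aestronglyMeasurable
    have h2 : ∫ x, f x ∂(gaussianReal 0 1) = p := by
      rw [hp, ← integral_indicator_one measurableSet_Ioi]
      refine integral_congr_ae (Filter.Eventually.of_forall fun x => ?_)
      simp [f, Set.indicator_apply]
    exact h1.trans h2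
  -- The sign is reversed so that the upper-tail bound controls the lower tail of the count.
  have hsub (q : Fin nL × Fin nR) :
      HasSubgaussianMGF (fun ω => -(f (Δ ω q.1 q.2) - p)) ((1 / 2) ^ 2) P := by
    have h1 := hasSubgaussianMGF_of_mem_Icc (a := 0) (b := 1) (μ := P)
      (X := fun ω => f (Δ ω q.1 q.2)) (hf.comp_aemeasurable (h.hasLaw q.1 q.2).aemeasurable)
      (Filter.Eventually.of_forall fun ω => by
        simp only [f]; split_ifs <;> simp)
    rw [hint] at h1
    simp only [sub_zero, nnnorm_one] at h1
    exact h1.neg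
  have hind : iIndepFun (fun (q : Fin nL × Fin nR) ω => -(f (Δ ω q.1 q.2) - p)) P :=
    h.indep.comp (fun q x => -(f x - p)) fun q => by fun_prop
  have hp0 : 0 ≤ p := hp ▸ measureReal_nonneg
  have key := HasSubgaussianMGF.measure_sum_ge_le_of_iIndepFun hind (s := Finset.univ)
    (fun q _ => hsub q) (ε := nL * nR * p / 2) (by positivity)
  have hset : {ω | ∑ i, ∑ j, (if 1 / 2 < Δ ω i j then (1 : ℝ) else 0) ≤ nL * nR * p / 2} =
      {ω | nL * nR * p / 2 ≤ ∑ q : Fin nL × Fin nR, -(f (Δ ω q.1 q.2) - p)} := by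
    ext ω
    simp only [Set.mem_ofPred_eq, Fintype.sum_prod_type, neg_sub, Finset.sum_sub_distrib,
      Finset.sum_const, Finset.card_univ, Fintype.card_prod, Fintype.card_fin, nsmul_eq_mul, Nat.cast_mul, f]
    constructor <;> intro h <;> linarith
  rw [hset]
  refine key.trans (le_of_eq ?_)
  congr 1
  simp only [Finset.sum_const, Finset.card_univ, Fintype.card_prod, Fintype.card_fin, nsmul_eq_mul]
  push_cast
  by_cases h0 : (nL : ℝ) * nR = 0
  · simp [h0]
  · field_simp

end IsGaussianNoise

theorem gaussianReal_real_Ioi_pos (x : ℝ) :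
    0 < (ProbabilityTheory.gaussianReal 0 1).real (Set.Ioi x) := by
  rw [MeasureTheory.measureReal_def, ENNReal.toReal_pos_iff]
  refine ⟨pos_iff_ne_zero.mpr fun h => ?_, MeasureTheory.measure_lt_top _ _⟩
  have := ProbabilityTheory.gaussianReal_absolutelyContinuous' 0 one_ne_zero h
  simp at this

/-! ### Failure of recovery under a weak signal. -/

theorem BiClustering.observation_eq {nL nR KL KR r : ℕ} (B : BiClustering nL nR KL KR r) (μ : ℝ)
    (Δ : Matrix (Fin nL) (Fin nR) ℝ) (i : Fin nL) (j : Fin nR) :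
    B.observation μ Δ i j = μ * B.matrix i j + Δ i j := by
  simp only [observation, matrix, Matrix.of_apply]
  split_ifs <;> simp

/-- If the noise has many entries above `1 / 2` and its sums over the clusters and over a widened
cluster are controlled, then the bi-clustering matrix is not optimal for a weak signal `μ`. -/
theorem BiClustering.not_isCvxOptimal_observation {n K r : ℕ} (B : BiClustering n n K K r)
    (m₀ : Fin r) (hK : 0 < K) (hKn : (K : ℝ) ≤ n / 2) {μ p τ : ℝ} (hμ0 : 0 < μ)
    (hμ : μ ≤ 1 / 100) (hp : 0 < p) (hpn : 1 ≤ n * p) (hμK : (K * μ) ^ 2 ≤ p * n / 256)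
    (hτK : τ ≤ K / 10) (hτn : τ ^ 2 ≤ p * n / 1024)
    (Δ : Matrix (Fin n) (Fin n) ℝ)
    (hcount : n * n * p / 2 < ∑ i, ∑ j, if 1 / 2 < Δ i j then (1 : ℝ) else 0)
    (hclusters : ∑ i, ∑ j, B.matrix i j * Δ i j ≤ r * K * τ)
    (hwiden : -((n - K) * τ) ≤ ∑ i, ∑ j, B.widening m₀ i j * Δ i j) :
    ¬ IsCvxOptimal K K r (B.observation μ Δ) B.matrix := by
  set N : ℝ := ∑ i, ∑ j, if 1 / 2 < Δ i j then (1 : ℝ) else 0 with hN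
  set b : ℝ := √n * √N with hb
  have hK' : (0 : ℝ) < K := by exact_mod_cast hK
  have hn : (0 : ℝ) < n := by linarith
  have hr : (0 : ℝ) < r := by exact_mod_cast m₀.pos
  have hg : (0 : ℝ) < n - K := by linarith
  have hrK : (r : ℝ) * K ≤ n := by exact_mod_cast B.mul_card_C_le
  have hN0 : 0 < N := lt_of_le_of_lt (by positivity) hcount
  have hb0 : 0 < b := by positivity
  have hbsq : b ^ 2 = n * N := by
    rw [hb, mul_pow, Real.sq_sqrt hn.le, Real.sq_sqrt hN0.le]
  have hKn' : K < n := by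
    have : (K : ℝ) < n := by linarith
    exact_mod_cast this
  have hbn : (n : ℝ) ≤ 2 * b := by
    apply le_of_sq_le_sq _ (by positivity)
    rw [mul_pow, hbsq]
    have : (n : ℝ) * (n * n * p / 2) ≤ n * N := by gcongr
    have : (n : ℝ) ^ 2 * 1 ≤ n ^ 2 * (n * p) := by gcongr
    nlinarith
  -- Squared, the left side is `N · n²p < 2N²`, and `2 ≤ 9/4`.
  have hbp : b * (√p * √n) ≤ 3 / 2 * N := by
    apply le_of_sq_le_sq _ (by positivity)
    rw [mul_pow b, mul_pow (√p), hbsq, Real.sq_sqrt hn.le, Real.sq_sqrt hp.le]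
    have : N * (n * n * p / 2) ≤ N * N := by gcongr
    nlinarith
  have hKμ : K * μ ≤ √p * √n / 16 := by
    apply le_of_sq_le_sq _ (by positivity)
    rw [div_pow, mul_pow (√p), Real.sq_sqrt hn.le, Real.sq_sqrt hp.le]
    linarith
  have hτ : τ ≤ √p * √n / 32 := by
    apply le_of_sq_le_sq _ (by positivity)
    rw [div_pow, mul_pow (√p), Real.sq_sqrt hn.le, Real.sq_sqrt hp.le]
    linarith
  set σ : ℝ := 2 * b / (r * K) + N / (r * K ^ 2) with hσ
  have hσ0 : 0 ≤ σ := by positivity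
  have hσ1 : 1 ≤ σ := by
    have h1 : 1 ≤ 2 * b / (r * K) := by
      rw [le_div_iff₀ (by positivity)]
      linarith
    have h2 : 0 ≤ N / (r * K ^ 2) := by positivity
    linarith
  refine B.not_isCvxOptimal_matrix m₀ hK hKn' (B.observation μ Δ)
    (Matrix.of fun i j => if 1 / 2 < Δ i j then 1 else 0)
    (fun i j => by simp only [Matrix.of_apply]; split_ifs <;> norm_num)
    (fun i j => by simp only [Matrix.of_apply]; split_ifs <;> norm_num) rfl hb hσ rfl hσ1 ?_
  have h1 : N / 2 ≤ ∑ i, ∑ j, B.observation μ Δ i j *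
      (Matrix.of fun i j => if 1 / 2 < Δ i j then (1 : ℝ) else 0) i j := by
    rw [hN, Finset.sum_div]
    refine Finset.sum_le_sum fun i _ => ?_
    rw [Finset.sum_div]
    refine Finset.sum_le_sum fun j _ => ?_
    rw [B.observation_eq, Matrix.of_apply]
    have := mul_nonneg hμ0.le (B.matrix_nonneg i j)
    split_ifs with h
    · linarith
    · simp
  have h2 : ∑ i, ∑ j, B.observation μ Δ i j * B.matrix i j ≤ μ * (r * K * K) + r * K * τ := by
    have : ∀ i j, B.observation μ Δ i j * B.matrix i j =
        μ * B.matrix i j + B.matrix i j * Δ i j := by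
      intro i j
      rw [B.observation_eq]
      have : B.matrix i j * B.matrix i j = B.matrix i j := by
        simp only [matrix, Matrix.of_apply]; split_ifs <;> norm_num
      linear_combination μ * this
    simp only [this, Finset.sum_add_distrib, ← Finset.mul_sum, B.sum_matrix]
    linarith
  have h3 : -((n - K) * τ) ≤ ∑ i, ∑ j, B.observation μ Δ i j * B.widening m₀ i j := by
    refine hwiden.trans (Finset.sum_le_sum fun i _ => Finset.sum_le_sum fun j _ => ?_)
    rw [B.observation_eq]
    have := mul_nonneg (mul_nonneg hμ0.le (B.matrix_nonneg i j)) (B.widening_nonneg m₀ i j)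
    linarith
  have h4 : σ * (∑ i, ∑ j, B.observation μ Δ i j * B.matrix i j) ≤
      2 * (b * (K * μ)) + N * μ + 2 * (b * τ) + N * (τ / K) := by
    calc _ ≤ σ * (μ * (r * K * K) + r * K * τ) := by gcongr
      _ = _ := by rw [hσ]; field_simp; ring
  have h5 : -(2 * (b * τ)) ≤
      2 * b / (n - K) * ∑ i, ∑ j, B.observation μ Δ i j * B.widening m₀ i j := by
    calc -(2 * (b * τ)) = 2 * b / (n - K) * (-((n - K) * τ)) := by field_simp
      _ ≤ _ := by gcongr
  have h6 : b * (K * μ) ≤ b * (√p * √n / 16) := by gcongr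
  have h7 : b * τ ≤ b * (√p * √n / 32) := by gcongr
  have h8 : N * μ ≤ N * (1 / 100) := by gcongr
  have h9 : N * (τ / K) ≤ N * (1 / 10) := by
    refine mul_le_mul_of_nonneg_left ?_ hN0.le
    rw [div_le_iff₀ hK']
    linarith
  -- In units of `N`, the losses are at most `3/16` (signal), `1/100`, `3/16` (both `bτ` terms) and
  -- `1/10`, in total less than `1/2`.
  linarith

-- Three bad events (few large entries, a large noise sum on the clusters, a very negative one on
-- the widening) each have probability at most `n⁻¹²`.
open MeasureTheory ProbabilityTheory in
theorem IsGaussianNoise.measureReal_not_isCvxOptimal {n K r : ℕ} (B : BiClustering n n K K r)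
    (m₀ : Fin r) (hK : 0 < K) (hKn : (K : ℝ) ≤ n / 2) {μ p : ℝ} (hμ0 : 0 < μ)
    (hμ : μ ≤ 1 / 100) (hp : p = (gaussianReal 0 1).real (Set.Ioi (1 / 2)))
    (hKlog : 12288 / p * Real.log n ≤ K) (hμK : μ ^ 2 ≤ p / 256 * (n / (K : ℝ) ^ 2))
    {Ω : Type*} [MeasurableSpace Ω] {P : Measure Ω} [IsProbabilityMeasure P]
    {Δ : Ω → Matrix (Fin n) (Fin n) ℝ} (hΔ : IsGaussianNoise Δ P) :
    1 - ((n : ℝ) ^ 10)⁻¹ ≤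
      P.real {ω | ¬ IsCvxOptimal K K r (B.observation μ (Δ ω)) B.matrix} := by
  have hp0 : 0 < p := hp ▸ gaussianReal_real_Ioi_pos _
  have hp1 : p ≤ 1 := hp ▸ measureReal_le_one
  have hK1 : (1 : ℝ) ≤ K := by exact_mod_cast hK
  have hr1 : (1 : ℝ) ≤ r := by exact_mod_cast m₀.pos
  have hn2 : (2 : ℝ) ≤ n := by linarith
  have hlog : 1 / 2 ≤ Real.log n := by
    have := Real.log_le_log two_pos hn2
    linarith [Real.log_two_gt_d9]
  have hKp : 12288 * Real.log n ≤ K * p := by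
    rwa [div_mul_eq_mul_div, div_le_iff₀ hp0] at hKlog
  have hKp' : (K : ℝ) * p ≤ K := mul_le_of_le_one_right (by linarith) hp1
  have hnp : 2 * (K * p) ≤ n * p := by nlinarith
  -- `τ²/2 = 12 log n` is the exponent of the tails. The constant `12288 = 24 · 1024 / 2` makes `τ²
  -- ≤ pn/1024`, using `2K ≤ n`.
  set τ := √(24 * Real.log n)
  have hτsq : τ ^ 2 = 24 * Real.log n := Real.sq_sqrt (by linarith)
  have hτ0 : 0 ≤ τ := Real.sqrt_nonneg _
  have hexp : Real.exp (-(12 * Real.log n)) = ((n : ℝ) ^ 12)⁻¹ := by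
    rw [Real.exp_neg, show (12 : ℝ) * Real.log n = ((12 : ℕ) : ℝ) * Real.log n by norm_num,
      Real.exp_nat_mul, Real.exp_log (by linarith)]
  set S₁ := {ω | ∑ i, ∑ j, (if 1 / 2 < Δ ω i j then (1 : ℝ) else 0) ≤ n * n * p / 2}
  set S₂ := {ω | r * K * τ ≤ ∑ i, ∑ j, B.matrix i j * Δ ω i j}
  set S₃ := {ω | (n - K) * τ ≤ ∑ i, ∑ j, (-B.widening m₀) i j * Δ ω i j}
  have h1 : P.real S₁ ≤ ((n : ℝ) ^ 12)⁻¹ := by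
    rw [← hexp]
    refine (hΔ.measureReal_sum_indicator_le hp).trans (Real.exp_le_exp.mpr ?_)
    nlinarith
  have h2 : P.real S₂ ≤ ((n : ℝ) ^ 12)⁻¹ := by
    rw [← hexp]
    refine (hΔ.measureReal_le_sum_mul_le B.matrix (by positivity)).trans (Real.exp_le_exp.mpr ?_)
    have hsum : ∑ i, ∑ j, B.matrix i j ^ 2 = r * K * K := by
      rw [← B.sum_matrix]
      refine Finset.sum_congr rfl fun i _ => Finset.sum_congr rfl fun j _ => ?_
      simp only [BiClustering.matrix, Matrix.of_apply]
      split_ifs <;> norm_num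
    rw [hsum, neg_div, neg_le_neg_iff, le_div_iff₀ (by positivity)]
    have : (r * K * τ) ^ 2 = r * (r * K ^ 2 * (24 * Real.log n)) := by rw [← hτsq]; ring
    rw [this]
    have h0 : 0 ≤ r * (K : ℝ) ^ 2 * (24 * Real.log n) := by positivity
    linarith [le_mul_of_one_le_left h0 hr1]
  have h3 : P.real S₃ ≤ ((n : ℝ) ^ 12)⁻¹ := by
    rw [← hexp]
    have hg : (0 : ℝ) < n - K := by linarith
    refine (hΔ.measureReal_le_sum_mul_le (-B.widening m₀) (by positivity)).trans
      (Real.exp_le_exp.mpr ?_)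
    have hsum : ∑ i, ∑ j, (-B.widening m₀) i j ^ 2 = K * (n - K) := by
      rw [← B.sum_widening m₀]
      refine Finset.sum_congr rfl fun i _ => Finset.sum_congr rfl fun j _ => ?_
      simp only [BiClustering.widening, Matrix.neg_apply, Matrix.of_apply]
      split_ifs <;> norm_num
    rw [hsum, neg_div, neg_le_neg_iff, le_div_iff₀ (by positivity), mul_pow, hτsq]
    have : (K : ℝ) * (n - K) ≤ (n - K) * (n - K) := by gcongr; linarith
    nlinarith
  have hsub : {ω | ¬ IsCvxOptimal K K r (B.observation μ (Δ ω)) B.matrix}ᶜ ⊆ S₁ ∪ S₂ ∪ S₃ := by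
    intro ω hω
    by_contra hbad
    simp only [Set.mem_union, not_or, S₁, S₂, S₃, Set.mem_ofPred_eq, not_le, Matrix.neg_apply,
      neg_mul, Finset.sum_neg_distrib] at hbad
    obtain ⟨⟨hb1, hb2⟩, hb3⟩ := hbad
    refine hω (B.not_isCvxOptimal_observation m₀ hK hKn hμ0 hμ hp0 ?_ ?_ ?_ ?_ (Δ ω) hb1
      hb2.le (by linarith))
    · linarith
    · calc (K * μ) ^ 2 = K ^ 2 * μ ^ 2 := by ring
        _ ≤ K ^ 2 * (p / 256 * (n / (K : ℝ) ^ 2)) := by gcongr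
        _ = p * n / 256 := by field_simp
    · apply le_of_sq_le_sq _ (by positivity)
      rw [hτsq]
      nlinarith
    · rw [hτsq]
      linarith
  have hunion : P.real {ω | ¬ IsCvxOptimal K K r (B.observation μ (Δ ω)) B.matrix}ᶜ ≤
      3 * ((n : ℝ) ^ 12)⁻¹ := by
    refine (measureReal_mono hsub).trans ?_
    have := measureReal_union_le (μ := P) (S₁ ∪ S₂) S₃
    have := measureReal_union_le (μ := P) S₁ S₂
    linarith
  -- The factor `3` is absorbed by `n² ≥ 4`.
  have hpow : 3 * ((n : ℝ) ^ 12)⁻¹ ≤ ((n : ℝ) ^ 10)⁻¹ := by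
    rw [← div_eq_mul_inv, div_le_iff₀ (by positivity), inv_mul_eq_div, le_div_iff₀ (by positivity)]
    have : (n : ℝ) ^ 12 = n ^ 10 * n ^ 2 := by ring
    rw [this, mul_comm]
    gcongr
    nlinarith
  have htotal := measureReal_union_le (μ := P)
    {ω | ¬ IsCvxOptimal K K r (B.observation μ (Δ ω)) B.matrix}
    {ω | ¬ IsCvxOptimal K K r (B.observation μ (Δ ω)) B.matrix}ᶜ
  rw [Set.union_compl_self, probReal_univ] at htotal
  linarith

theorem theorem10 :
    ∃ c₁ c₂ : ℝ, 0 < c₁ ∧ 0 < c₂ ∧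
      ∀ (n K r : ℕ) (μ : ℝ), 1 ≤ r → 1 ≤ K → 0 < μ → μ ≤ 1 / 100 →
        c₁ * Real.log n ≤ K → (K : ℝ) ≤ n / 2 →
        μ ^ 2 ≤ c₂ * (n / (K : ℝ) ^ 2) →
        ∀ (B : BiClustering n n K K r)
          (Ω : Type*) [MeasurableSpace Ω] (P : MeasureTheory.Measure Ω)
          [MeasureTheory.IsProbabilityMeasure P]
          (Δ : Ω → Matrix (Fin n) (Fin n) ℝ), IsGaussianNoise Δ P →
          1 - ((n : ℝ) ^ 10)⁻¹ ≤
            P.real {ω | ∀ Y : Matrix (Fin n) (Fin n) ℝ,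
              IsCvxOptimal K K r (B.observation μ (Δ ω)) Y →
                matrixSupport Y ≠ matrixSupport B.matrix} := by
  have hp := gaussianReal_real_Ioi_pos (1 / 2)
  refine ⟨12288 / (ProbabilityTheory.gaussianReal 0 1).real (Set.Ioi (1 / 2)),
    (ProbabilityTheory.gaussianReal 0 1).real (Set.Ioi (1 / 2)) / 256, div_pos (by norm_num) hp, div_pos hp (by norm_num), ?_⟩
  intro n K r μ hr hK hμ0 hμ hlog hKn hμK B Ω _ P _ Δ hΔ
  refine (IsGaussianNoise.measureReal_not_isCvxOptimal B ⟨0, hr⟩ hK hKn hμ0 hμ rfl hlog hμK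
    hΔ).trans (MeasureTheory.measureReal_mono fun ω hω Y hY hsupp => hω ?_)
  rwa [← (B.matrixSupport_eq_iff hY.1).mp hsupp]
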